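/- Let $f:X\to X$ be a continuous map on a compact metric space with finite topological entropy, let $\mathcal M$ be the set of $f$-invariant Borel probability measures with the weak$^*$ topology, and assume that the entropy map $\mu\mapsto h_\mu(f)$ is upper semi-continuous on $\mathcal M$. Let $\Phi=(\phi_1,\dots,\phi_m):X\to\mathbb R^m$ be continuous. For $\mu\in\mathcal M$ put $\mathrm{rv}(\mu)=(\int\phi_1\,d\mu,\dots,\int\phi_m\,d\mu)$, and let $\mathrm{Rot}(\Phi)=\{\mathrm{rv}(\mu):\mu\in\mathcal M\}$ be the rotation set. For a unit vector $\alpha\in\mathbb R^m$ let $H_\alpha(\Phi)$ be the supporting hyperplane of $\mathrm{Rot}(\Phi)$ whose normal $\alpha$ points away from $\mathrm{Rot}(\Phi)$, and let $F_\alpha(\Phi)=\mathrm{Rot}(\Phi)\cap H_\alpha(\Phi)$; for $w\in\partial\,\mathrm{Rot}(\Phi)$ let $\gamma(w)$ be the set of unit vectors $\alpha$ with $w\in H_\alpha(\Phi)$. For continuous $\varphi:X\to\mathbb R$ let $ES(\varphi)$ be the set of $\mu\in\mathcal M$ with $h_\mu(f)+\int\varphi\,d\mu=\sup_{\nu\in\mathcal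 M}\bigl(h_\nu(f)+\int\varphi\,d\nu\bigr)$. The set $GS(\alpha)$ of ground states in direction $\alpha$ consists of all $\mu\in\mathcal M$ for which there are an increasing sequence $t_n\to\infty$ and $\mu_n\in ES(t_n\,\alpha\cdot\Phi)$ with $\mu_n\to\mu$. Let $w\in\partial\,\mathrm{Rot}(\Phi)$ be an exposed point of $\mathrm{Rot}(\Phi)$, that is, $\{w\}=\mathrm{Rot}(\Phi)\cap H$ for some supporting hyperplane $H$. 1. For every $\alpha\in\gamma(w)$ with $F_\alpha(\Phi)=\{w\}$ and every $\mu\in GS(\alpha)$ we have $\mathrm{rv}(\mu)=w$ and $h_\mu(f)=\sup\{h_\nu(f):\nu\in\mathcal M,\ \mathrm{rv}(\nu)=w\}$. 2. Suppose that there is exactly one measure $\mu\in\mathcal M$ with $\mathrm{rv}(\mu)=w$ and $h_\mu(f)=\sup\{h_\nu(f):\nu\in\mathcal M,\ \mathrm{rv}(\nu)=w\}$. Then $GS(\alpha)=\{\mu\}$ for every $\alpha\in\gamma(w)$ with $F_\alpha(\Phi)=\{w\}$. In particular, for such $\alpha$, if $ES(t\,\alpha\cdot\Phi)$ is a singleton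 $\{\mu_t\}$ for all large enough $t$, then $\mu_t\to\mu$ in the weak$^*$ topology as $t\to\infty$, that is, $\mu$ is the zero-temperature measure in the direction of $\alpha$. -/

import Mathlib

open Filter Topology MeasureTheory

noncomputable section

namespace RotEntropy

section Entropy

variable {X : Type*} [MeasurableSpace X]

/-- Shannon entropy `-∑ₐ μ(ξ = a) log μ(ξ = a)` of the finite partition of `X` into the
level sets of `ξ : X → ι`. -/
def partitionEntropy {ι : Type*} [Fintype ι] (μ : Measure X) (ξ : X → ι) : ℝ :=
  ∑ a, Real.negMulLog (μ.real (ξ ⁻¹' {a}))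

/-- Labelling of the join `⋁_{i < n} f^{-i} ξ`: the `n`-step itinerary of a point. -/
def itinerary {ι : Type*} (f : X → X) (ξ : X → ι) (n : ℕ) (x : X) : Fin n → ι :=
  fun i => ξ (f^[i] x)

/-- `h_μ(f, ξ) = lim (1/n) H_μ(⋁_{i < n} f^{-i} ξ)`; for invariant `μ` the limit exists, so it is
the upper limit. -/
def entropyOfPartition {ι : Type*} [Fintype ι] (f : X → X) (μ : Measure X) (ξ : X → ι) : EReal :=
  limsup (fun n : ℕ => ((partitionEntropy μ (itinerary f ξ n) / n : ℝ) : EReal)) atTop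

/-- Measure-theoretic (Kolmogorov–Sinai) entropy `h_μ(f)`: the supremum of `h_μ(f, ξ)` over all
finite measurable partitions, a partition being given by a measurable labelling. -/
def entropy (f : X → X) (μ : Measure X) : EReal :=
  ⨆ (k : ℕ) (ξ : X → Fin k) (_ : Measurable ξ), entropyOfPartition f μ ξ

/-- The set `M` of `f`-invariant probability measures. -/
def invariantMeasures (f : X → X) : Set (ProbabilityMeasure X) :=
  {μ | MeasurePreserving f (μ : Measure X) (μ : Measure X)}

/-- Free energy `h_μ(f) + ∫ φ dμ`. -/
def freeEnergy (f : X → X) (φ : X → ℝ) (μ : ProbabilityMeasure X) : EReal :=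
  entropy f (μ : Measure X) + ((∫ x, φ x ∂(μ : Measure X) : ℝ) : EReal)

/-- `ES(φ)`: invariant measures attaining `sup {h_ν(f) + ∫ φ dν : ν ∈ M}`. -/
def equilibriumStates (f : X → X) (φ : X → ℝ) : Set (ProbabilityMeasure X) :=
  {μ | μ ∈ invariantMeasures f ∧
    freeEnergy f φ μ = ⨆ ν ∈ invariantMeasures f, freeEnergy f φ ν}

variable [TopologicalSpace X] [OpensMeasurableSpace X]

/-- `GS(φ)`: weak* limits of equilibrium states of `t_n φ` along increasing `t_n → ∞`. -/
def groundStates (f : X → X) (φ : X → ℝ) : Set (ProbabilityMeasure X) :=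
  {μ | μ ∈ invariantMeasures f ∧
    ∃ (t : ℕ → ℝ) (ν : ℕ → ProbabilityMeasure X),
      StrictMono t ∧ Tendsto t atTop atTop ∧
      (∀ n, ν n ∈ equilibriumStates f (fun x => t n * φ x)) ∧
      Tendsto ν atTop (𝓝 μ)}

/-- `μ` is the zero-temperature measure of `φ`: for all `t ≥ t₀` the potential `t φ` has exactly
one equilibrium state `ν t`, and `ν t → μ` in the weak* topology as `t → ∞`. -/
def IsZeroTemperatureMeasure (f : X → X) (φ : X → ℝ) (μ : ProbabilityMeasure X) : Prop :=
  μ ∈ invariantMeasures f ∧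
    ∃ (t₀ : ℝ) (ν : ℝ → ProbabilityMeasure X), 0 ≤ t₀ ∧
      (∀ t, t₀ ≤ t → equilibriumStates f (fun x => t * φ x) = {ν t}) ∧
      Tendsto ν atTop (𝓝 μ)

end Entropy

section Convex

variable {m : ℕ}

/-- The hyperplane `{u : α · u = a}`. -/
def hyperplane (α : EuclideanSpace ℝ (Fin m)) (a : ℝ) : Set (EuclideanSpace ℝ (Fin m)) :=
  {u | inner ℝ α u = a}

/-- The hyperplane `{u : α · u = a}` cuts `K`: both open half spaces contain points of `K`. -/
def Cuts (α : EuclideanSpace ℝ (Fin m)) (a : ℝ) (K : Set (EuclideanSpace ℝ (Fin m))) : Prop :=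
  (∃ v ∈ K, inner ℝ α v < a) ∧ (∃ v ∈ K, a < inner ℝ α v)

/-- The hyperplane `{u : α · u = a}` supports `K`: it has distance zero to `K` and does not
cut `K`. -/
def IsSupporting (α : EuclideanSpace ℝ (Fin m)) (a : ℝ)
    (K : Set (EuclideanSpace ℝ (Fin m))) : Prop :=
  α ≠ 0 ∧ (⨅ v ∈ K, Metric.infEDist v (hyperplane α a)) = 0 ∧ ¬ Cuts α a K

/-- A face of `K` is the intersection of `K` with a supporting hyperplane. -/
def IsFace (K F : Set (EuclideanSpace ℝ (Fin m))) : Prop :=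
  ∃ α a, IsSupporting α a K ∧ F = K ∩ hyperplane α a

/-- `w` is an exposed point of `K`: `{w}` is a face of `K`. -/
def IsExposedPoint (K : Set (EuclideanSpace ℝ (Fin m))) (w : EuclideanSpace ℝ (Fin m)) : Prop :=
  w ∈ K ∧ IsFace K {w}

/-- The supporting hyperplane of `K` whose normal `α` points away from `K`, i.e. such that the
open half space `{v : a < α · v}` into which `α` points does not meet `K`.  (The number `a` is
unique when `K` is non-empty and bounded.) -/
def supportingHyperplane (K : Set (EuclideanSpace ℝ (Fin m))) (α : EuclideanSpace ℝ (Fin m)) :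
    Set (EuclideanSpace ℝ (Fin m)) :=
  {u | ∃ a, IsSupporting α a K ∧ (∀ v ∈ K, ¬ a < inner ℝ α v) ∧ u ∈ hyperplane α a}

end Convex

section Rotation

variable {X : Type*} [MeasurableSpace X] {m : ℕ}

/-- Rotation vector `rv(μ) = (∫ φ₁ dμ, …, ∫ φ_m dμ)`. -/
def rv (Φ : X → EuclideanSpace ℝ (Fin m)) (μ : ProbabilityMeasure X) :
    EuclideanSpace ℝ (Fin m) :=
  WithLp.toLp 2 (fun i => ∫ x, Φ x i ∂(μ : Measure X))

/-- The rotation set `Rot(Φ) = {rv(μ) : μ ∈ M}`. -/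
def Rot (f : X → X) (Φ : X → EuclideanSpace ℝ (Fin m)) : Set (EuclideanSpace ℝ (Fin m)) :=
  rv Φ '' invariantMeasures f

/-- The rotation class of `w`: invariant measures with rotation vector `w`. -/
def rotationClass (f : X → X) (Φ : X → EuclideanSpace ℝ (Fin m))
    (w : EuclideanSpace ℝ (Fin m)) : Set (ProbabilityMeasure X) :=
  {μ | μ ∈ invariantMeasures f ∧ rv Φ μ = w}

/-- Localized entropy `H(w) = sup {h_μ(f) : μ ∈ M, rv(μ) = w}`. -/
def localizedEntropy (f : X → X) (Φ : X → EuclideanSpace ℝ (Fin m))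
    (w : EuclideanSpace ℝ (Fin m)) : EReal :=
  ⨆ μ ∈ rotationClass f Φ w, entropy f (μ : Measure X)

/-- The localized measures of maximal entropy at `w`. -/
def localizedMaxEntropyMeasures (f : X → X) (Φ : X → EuclideanSpace ℝ (Fin m))
    (w : EuclideanSpace ℝ (Fin m)) : Set (ProbabilityMeasure X) :=
  {μ | μ ∈ rotationClass f Φ w ∧ entropy f (μ : Measure X) = localizedEntropy f Φ w}

/-- The face `F_α(Φ) = Rot(Φ) ∩ H_α(Φ)`. -/
def face (f : X → X) (Φ : X → EuclideanSpace ℝ (Fin m)) (α : EuclideanSpace ℝ (Fin m)) :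
    Set (EuclideanSpace ℝ (Fin m)) :=
  Rot f Φ ∩ supportingHyperplane (Rot f Φ) α

/-- `γ(w)`: the direction vectors (unit vectors) `α` with `w ∈ H_α(Φ)`. -/
def directionVectors (f : X → X) (Φ : X → EuclideanSpace ℝ (Fin m))
    (w : EuclideanSpace ℝ (Fin m)) : Set (EuclideanSpace ℝ (Fin m)) :=
  {α | ‖α‖ = 1 ∧ w ∈ supportingHyperplane (Rot f Φ) α}

/-- The one-dimensional potential `α · Φ`. -/
def dotPotential (α : EuclideanSpace ℝ (Fin m)) (Φ : X → EuclideanSpace ℝ (Fin m)) : X → ℝ :=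
  fun x => inner ℝ α (Φ x)

end Rotation

end RotEntropy

end

/-! For an equilibrium state `ρ` of `t φ` and any invariant `ν`, h(ν) + t∫φ dν ≤ h(ρ) + t∫φ dρ.
Entropies lie in a bounded interval [0, C], so dividing by t → ∞ shows that limits of such `ρ`
maximize ∫φ. If `ν` already maximizes ∫φ, the inequality forces h(ν) ≤ h(ρ) for t > 0, and upper
semicontinuity carries this to the limit (`integral_eq_and_entropy_le_of_mem_groundStates`). For φ =
α · Φ the maximizers of the integral are exactly the measures with rotation vector in the face, here
{w}. Uniqueness and compactness of the invariant measures then give the second part.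

The bound C rests on `entropy_lt_top`. A sharp variational inequality is not needed: coding
itineraries by a minimal dynamical cover gives h_μ ≤ h_top + log 2 + 1, which suffices. -/

namespace RotEntropy

/-! ### Coding bounds for the entropy of a partition -/

/-- **Gibbs' inequality** for finite distributions. -/
theorem sum_negMulLog_le_sum_mul_neg_log {ι : Type*} [Fintype ι] {p q : ι → ℝ}
    (hp : ∀ a, 0 ≤ p a) (hp1 : ∑ a, p a = 1) (hq : ∀ a, 0 < q a) (hq1 : ∑ a, q a ≤ 1) :
    ∑ a, Real.negMulLog (p a) ≤ ∑ a, p a * (-Real.log (q a)) := by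
  have key : ∀ a, Real.negMulLog (p a) - p a * (-Real.log (q a)) ≤ q a - p a := by
    intro a
    rcases (hp a).eq_or_lt with h | h
    · simp [← h, (hq a).le]
    · have h1 := Real.log_le_sub_one_of_pos (div_pos (hq a) h)
      rw [Real.log_div (hq a).ne' h.ne'] at h1
      have h2 := mul_le_mul_of_nonneg_left h1 h.le
      have h3 : p a * (q a / p a - 1) = q a - p a := by field_simp
      rw [h3] at h2
      simp only [Real.negMulLog]
      linarith
  have := Finset.sum_le_sum fun a (_ : a ∈ Finset.univ) => key a
  simp only [Finset.sum_sub_distrib] at this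
  linarith

section

variable {X : Type*} [MeasurableSpace X]

theorem partitionEntropy_nonneg {ι : Type*} [Fintype ι] (μ : Measure X) [IsProbabilityMeasure μ]
    (ξ : X → ι) : 0 ≤ partitionEntropy μ ξ :=
  Finset.sum_nonneg fun _ _ => Real.negMulLog_nonneg measureReal_nonneg measureReal_le_one

/-- The entropy of a partition is at most the mean code length of any code given by a
subprobability vector. -/
theorem partitionEntropy_le_integral {ι : Type*} [Fintype ι] [MeasurableSpace ι]
    [MeasurableSingletonClass ι] (μ : Measure X) [IsProbabilityMeasure μ] {η : X → ι}
    (hη : Measurable η) {q : ι → ℝ} (hq : ∀ a, 0 < q a) (hq1 : ∑ a, q a ≤ 1) {g : X → ℝ}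
    (hg : Integrable g μ) (hle : ∀ x, -Real.log (q (η x)) ≤ g x) :
    partitionEntropy μ η ≤ ∫ x, g x ∂μ := by
  have hmap : ∀ a, μ.real (η ⁻¹' {a}) = (μ.map η).real {a} := fun a => by
    rw [map_measureReal_apply hη (measurableSet_singleton a)]
  have : IsProbabilityMeasure (μ.map η) := Measure.isProbabilityMeasure_map hη.aemeasurable
  have hsum : ∑ a, μ.real (η ⁻¹' {a}) = 1 := by
    simp_rw [hmap]
    simp
  have hint : Integrable (fun a => -Real.log (q a)) (μ.map η) := Integrable.of_finite
  calc partitionEntropy μ η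
      ≤ ∑ a, μ.real (η ⁻¹' {a}) * (-Real.log (q a)) :=
        sum_negMulLog_le_sum_mul_neg_log (fun _ => measureReal_nonneg) hsum hq hq1
    _ = ∫ a, -Real.log (q a) ∂(μ.map η) := by
        rw [integral_fintype hint]
        simp_rw [hmap, smul_eq_mul]
    _ = ∫ x, -Real.log (q (η x)) ∂μ :=
        integral_map hη.aemeasurable hint.aestronglyMeasurable
    _ ≤ ∫ x, g x ∂μ := integral_mono (hint.comp_measurable hη) hg hle

theorem measurable_itinerary {ι : Type*} [MeasurableSpace ι] {f : X → X} (hf : Measurable f)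
    {ξ : X → ι} (hξ : Measurable ξ) (n : ℕ) : Measurable (itinerary f ξ n) :=
  measurable_pi_lambda _ fun i => hξ.comp (hf.iterate i)

theorem entropyOfPartition_nonneg {ι : Type*} [Fintype ι] (f : X → X) (μ : Measure X)
    [IsProbabilityMeasure μ] (ξ : X → ι) : 0 ≤ entropyOfPartition f μ ξ := by
  refine le_limsup_of_frequently_le (Frequently.of_forall fun n => ?_)
  exact_mod_cast div_nonneg (partitionEntropy_nonneg μ _) n.cast_nonneg

theorem entropy_nonneg (f : X → X) (μ : Measure X) [IsProbabilityMeasure μ] :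
    0 ≤ entropy f μ := by
  obtain ⟨x⟩ : Nonempty X := nonempty_of_isProbabilityMeasure μ
  exact (entropyOfPartition_nonneg f μ fun _ => (0 : Fin 1)).trans
    (le_iSup_of_le 1 <| le_iSup_of_le _ <| le_iSup_of_le measurable_const le_rfl)

/-- If finitely many points `c` shadow all orbits of length `n` up to visits to a set `B`, in the
sense that the symbols outside `B` are predicted by `ℓ (f^i c)`, then the entropy of the `n`-step
itinerary is bounded by the logarithm of the number of these points plus a linear term. -/
theorem partitionEntropy_itinerary_le {k : ℕ} {f : X → X} {μ : Measure X} [IsProbabilityMeasure μ]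
    (hf : MeasurePreserving f μ μ) {ξ : X → Fin k} (hξ : Measurable ξ) {B : Set X}
    (hB : MeasurableSet B) (ℓ : X → Fin k) (n : ℕ) (s : Finset X)
    (hs : ∀ x, ∃ c ∈ s, ∀ i < n, f^[i] x ∉ B → ξ (f^[i] x) = ℓ (f^[i] c)) :
    partitionEntropy μ (itinerary f ξ n) ≤
      Real.log s.card + n * (Real.log 2 + μ.real B * Real.log k) := by
  classical
  obtain ⟨x₀⟩ : Nonempty X := nonempty_of_isProbabilityMeasure μ
  have hk : 0 < (k : ℝ) := by exact_mod_cast (ξ x₀).pos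
  have hM : 0 < (s.card : ℝ) := by
    obtain ⟨c, hc, -⟩ := hs x₀
    exact_mod_cast Finset.card_pos.2 ⟨c, hc⟩
  -- Half the mass on the predicted symbol, half spread uniformly: a correct prediction costs at
  -- most log 2, and any symbol at most log (2k).
  set κ : X → Fin k → ℝ := fun y a => (1 / 2) * (if a = ℓ y then 1 else 0) + 1 / (2 * k) with hκ
  have hκpos : ∀ y a, 0 < κ y a := fun y a => by
    simp only [hκ]
    have : 0 < 1 / (2 * (k : ℝ)) := by positivity
    split_ifs <;> linarith
  have hκsum : ∀ y, ∑ a, κ y a = 1 := fun y => by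
    simp only [hκ, Finset.sum_add_distrib, ← Finset.mul_sum]
    simp
    field_simp
    norm_num
  -- Averaging the product codes over `s` avoids choosing the shadowing point measurably; keeping
  -- only one summand costs log |s|.
  set q : (Fin n → Fin k) → ℝ := fun a => (s.card : ℝ)⁻¹ * ∑ c ∈ s, ∏ i : Fin n, κ (f^[i] c) (a i) with hqdef
  have hqpos : ∀ a, 0 < q a := fun a => by
    refine mul_pos (inv_pos.2 hM) (Finset.sum_pos (fun c _ => Finset.prod_pos fun i _ => hκpos _ _) ?_)
    exact Finset.card_pos.1 (by exact_mod_cast hM)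
  have hqsum : ∑ a, q a = 1 := by
    simp only [hqdef, ← Finset.mul_sum]
    rw [Finset.sum_comm]
    have : ∀ c, ∑ a : Fin n → Fin k, ∏ i : Fin n, κ (f^[i] c) (a i) = 1 := fun c => by
      have h := Finset.prod_univ_sum (fun _ : Fin n => (Finset.univ : Finset (Fin k)))
        (fun i a => κ (f^[i] c) a)
      rw [Fintype.piFinset_univ] at h
      rw [← h]
      simp [hκsum]
    simp [this, hM.ne']
  -- Bound on the code length of one symbol; by invariance its mean is the same at each time.
  set b : X → ℝ := fun x => Real.log 2 + B.indicator (fun _ => Real.log k) x with hb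
  have hbint : Integrable b μ :=
    (integrable_const _).add ((integrable_const _).indicator hB)
  have hbi : ∫ x, b x ∂μ = Real.log 2 + μ.real B * Real.log k := by
    simp only [hb]
    rw [integral_add (integrable_const _) ((integrable_const _).indicator hB),
      integral_indicator hB]
    simp
  have hbn : ∀ i, Integrable (fun x => b (f^[i] x)) μ := fun i =>
    (hf.iterate i).integrable_comp_of_integrable hbint
  have hbni : ∀ i, ∫ x, b (f^[i] x) ∂μ = ∫ x, b x ∂μ := fun i => by
    have h := (hf.iterate i)
    conv_rhs => rw [← h.map_eq]
    rw [integral_map h.measurable.aemeasurable]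
    rw [h.map_eq]; exact hbint.aestronglyMeasurable
  have hsint : Integrable (fun x => ∑ i : Fin n, b (f^[i] x)) μ :=
    integrable_finsetSum _ fun i _ => hbn i
  have hle : ∀ x, -Real.log (q (itinerary f ξ n x)) ≤ Real.log s.card + ∑ i : Fin n, b (f^[i] x) := by
    intro x
    obtain ⟨c, hc, hcx⟩ := hs x
    have h1 : ∏ i : Fin n, κ (f^[i] c) (ξ (f^[i] x)) ≤ s.card * q (itinerary f ξ n x) := by
      simp only [hqdef]
      rw [mul_inv_cancel_left₀ hM.ne']
      exact Finset.single_le_sum (f := fun c => ∏ i : Fin n, κ (f^[i] c) (itinerary f ξ n x i))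
        (fun c _ => Finset.prod_nonneg fun i _ => (hκpos _ _).le) hc
    have h2 := Real.log_le_log (Finset.prod_pos fun i _ => hκpos _ _) h1
    rw [Real.log_mul hM.ne' (hqpos _).ne', Real.log_prod fun i _ => (hκpos _ _).ne'] at h2
    have h3 : ∀ i : Fin n, -b (f^[i] x) ≤ Real.log (κ (f^[i] c) (ξ (f^[i] x))) := by
      intro i
      by_cases hi : f^[i] x ∈ B
      · have : b (f^[i] x) = Real.log (2 * k) := by
          simp [hb, hi, Real.log_mul two_ne_zero hk.ne']
        rw [this, ← Real.log_inv]
        refine Real.log_le_log (by positivity) ?_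
        simp only [hκ, one_div]
        split_ifs <;> simp
      · have : b (f^[i] x) = Real.log 2 := by simp [hb, hi]
        rw [this, ← Real.log_inv]
        refine Real.log_le_log (by positivity) ?_
        simp only [hκ, hcx i i.2 hi, if_true]
        have : 0 < 1 / (2 * (k : ℝ)) := by positivity
        norm_num at this ⊢
    have h4 := Finset.sum_le_sum fun i (_ : i ∈ Finset.univ) => h3 i
    rw [Finset.sum_neg_distrib] at h4
    linarith
  refine (partitionEntropy_le_integral μ (measurable_itinerary hf.measurable hξ n) hqpos hqsum.le
    ((integrable_const _).add hsint) hle).trans_eq ?_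
  rw [integral_add' (integrable_const _) hsint, integral_finsetSum _ fun (i : Fin n) _ => hbn i]
  simp [hbni, hbi, mul_add]

end

/-! ### Finite topological entropy bounds measure entropy -/

section

variable {X : Type*} [MetricSpace X] [CompactSpace X] [MeasurableSpace X] [BorelSpace X]

/-- A finite measurable partition is, up to a set of small measure, predicted at small scales by
the position of a nearby point. -/
theorem exists_local_prediction {k : ℕ} (μ : Measure X) [IsProbabilityMeasure μ] {ξ : X → Fin k}
    (hξ : Measurable ξ) : ∃ B : Set X, MeasurableSet B ∧ μ.real B * Real.log k ≤ 1 ∧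
      ∃ ℓ : X → Fin k, ∃ V ∈ uniformity X, ∀ x y, (x, y) ∈ V → x ∉ B → ξ x = ℓ y := by
  obtain ⟨x₀⟩ : Nonempty X := nonempty_of_isProbabilityMeasure μ
  have hk : 0 < (k : ℝ) := by exact_mod_cast (ξ x₀).pos
  -- There are k exceptional pieces, each of measure at most ε, and log k ≤ k; so μ(B) log k ≤ k · ε
  -- · k = 1.
  set ε : ℝ := 1 / (k * k) with hε
  have hεpos : 0 < ε := by positivity
  have hA : ∀ j, MeasurableSet (ξ ⁻¹' {j}) := fun j => hξ (measurableSet_singleton j)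
  choose F hFA hF hFμ using fun j => (hA j).exists_isClosed_sdiff_lt (μ := μ)
    (measure_ne_top _ _) (ENNReal.ofReal_pos.2 hεpos).ne'
  have hFξ : ∀ {j x}, x ∈ F j → ξ x = j := fun h => hFA _ h
  -- The closed sets `F j` are disjoint, so the sets avoiding all but one of them form an open
  -- cover. Below its Lebesgue scale a neighbourhood of `y` meets only `F (ℓ y)`, if any.
  obtain ⟨V, hV, hVU⟩ := lebesgue_number_lemma (K := (Set.univ : Set X))
    (U := fun j => (⋃ i ∈ {i | i ≠ j}, F i)ᶜ) isCompact_univ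
    (fun j => ((Set.toFinite _).isClosed_biUnion fun i _ => hF i).isOpen_compl) (by
      intro x _
      refine Set.mem_iUnion.2 ⟨ξ x, ?_⟩
      simp only [Set.mem_compl_iff, Set.mem_iUnion, not_exists]
      intro i hi hx
      exact hi (hFξ hx).symm)
  choose ℓ hℓ using fun y => hVU y (Set.mem_univ y)
  refine ⟨⋃ j, (ξ ⁻¹' {j} \ F j), MeasurableSet.iUnion fun j => (hA j).diff (hF j).measurableSet,
    ?_, ℓ, Prod.swap ⁻¹' V, tendsto_swap_uniformity hV, ?_⟩
  · have h1 : μ.real (⋃ j, (ξ ⁻¹' {j} \ F j)) ≤ k * ε := by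
      refine (measureReal_iUnion_fintype_le _).trans ?_
      refine (Finset.sum_le_card_nsmul _ _ ε fun j _ => ?_).trans_eq (by simp)
      exact ENNReal.toReal_le_of_le_ofReal hεpos.le (hFμ j).le
    have h2 : Real.log k ≤ k := Real.log_le_self hk.le
    have h3 : 0 ≤ Real.log k := Real.log_natCast_nonneg k
    calc _ ≤ k * ε * k := mul_le_mul h1 h2 h3 (by positivity)
      _ = 1 := by rw [hε]; field_simp
  · intro x y hxy hx
    have hxF : x ∈ F (ξ x) := by
      by_contra h
      exact hx (Set.mem_iUnion.2 ⟨ξ x, rfl, h⟩)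
    have := hℓ y hxy
    by_contra hne
    exact this (Set.mem_biUnion (show ξ x ∈ {i | i ≠ ℓ y} from hne) hxF)

/-- Measure-theoretic entropy is finite if topological entropy is. -/
theorem entropy_lt_top {f : X → X} (hf : Continuous f)
    (htop : Dynamics.coverEntropy f Set.univ < ⊤) {μ : Measure X} [IsProbabilityMeasure μ]
    (hμ : MeasurePreserving f μ μ) : entropy f μ < ⊤ := by
  obtain ⟨C, hC, -⟩ := EReal.lt_iff_exists_real_btwn.1 htop
  -- The bound must not depend on the partition; this is why `B` is chosen with μ(B) log k ≤ 1.
  refine lt_of_le_of_lt (b := ((C + (Real.log 2 + 1) : ℝ) : EReal)) ?_ (EReal.coe_lt_top _)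
  refine iSup_le fun k => iSup_le fun ξ => iSup_le fun hξ => ?_
  obtain ⟨B, hB, hBk, ℓ, V, hV, hℓ⟩ := exists_local_prediction μ hξ
  have hVC : Dynamics.coverEntropyEntourage f Set.univ V < C :=
    (Dynamics.coverEntropyEntourage_le_coverEntropy f _ hV).trans_lt hC
  refine limsup_le_of_le (h := ?_)
  filter_upwards [eventually_lt_of_limsup_lt hVC, eventually_gt_atTop 0] with n hn hn0
  obtain ⟨s, hs, hcard⟩ := (Dynamics.coverMincard_finite_iff f Set.univ V n).1
    (Dynamics.coverMincard_finite_of_isCompact_uniformContinuous isCompact_univ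
      (CompactSpace.uniformContinuous_of_continuous hf) hV n)
  have hs' : ∀ x, ∃ c ∈ s, ∀ i < n, f^[i] x ∉ B → ξ (f^[i] x) = ℓ (f^[i] c) := fun x => by
    obtain ⟨c, hc, hxc⟩ := hs (Set.mem_univ x)
    exact ⟨c, hc, fun i hi => hℓ _ _ (Dynamics.mem_dynEntourage.1 hxc i hi)⟩
  have hle := partitionEntropy_itinerary_le hμ hξ hB ℓ n s hs'
  obtain ⟨x₀⟩ : Nonempty X := nonempty_of_isProbabilityMeasure μ
  have hM : 0 < s.card := by
    obtain ⟨c, hc, -⟩ := hs' x₀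
    exact Finset.card_pos.2 ⟨c, hc⟩
  have hn0' : (0 : ℝ) < n := by exact_mod_cast hn0
  have hlog : Real.log s.card < C * n := by
    rw [← hcard, EReal.div_lt_iff (by exact_mod_cast hn0) (by exact EReal.natCast_ne_top n),
      ENNReal.log_pos_real (by simpa using hM.ne') (by simp)] at hn
    have : ((C : EReal) * (n : EReal)) = ((C * n : ℝ) : EReal) := by push_cast; rfl
    rw [this] at hn
    simpa using EReal.coe_lt_coe_iff.1 hn
  rw [EReal.coe_le_coe_iff, div_le_iff₀ hn0']
  nlinarith

end

/-! ### Equilibrium states and ground states -/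

section

variable {X : Type*} [MetricSpace X] [CompactSpace X] [MeasurableSpace X] [BorelSpace X]

theorem integrable_of_continuous {φ : X → ℝ} (hφ : Continuous φ) (μ : Measure X)
    [IsFiniteMeasure μ] : Integrable φ μ :=
  hφ.integrable_of_hasCompactSupport (HasCompactSupport.of_compactSpace φ)

theorem continuous_integral {φ : X → ℝ} (hφ : Continuous φ) :
    Continuous fun μ : ProbabilityMeasure X => ∫ x, φ x ∂(μ : Measure X) :=
  ProbabilityMeasure.continuous_integral_boundedContinuousFunction
    (BoundedContinuousFunction.mkOfCompact ⟨φ, hφ⟩)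

/-- Invariant measures are the fixed points of the continuous push-forward on a compact Hausdorff
space. -/
theorem isCompact_invariantMeasures {f : X → X} (hf : Continuous f) :
    IsCompact (invariantMeasures f) := by
  have : invariantMeasures f =
      {μ : ProbabilityMeasure X | μ.map hf.measurable.aemeasurable = μ} := by
    ext μ
    refine ⟨fun h => ?_, fun h => ⟨hf.measurable, ?_⟩⟩
    · exact Subtype.ext (by simpa using MeasurePreserving.map_eq h)
    · simpa using congrArg (fun ν : ProbabilityMeasure X => (ν : Measure X)) h
  rw [this]
  exact (isClosed_eq (ProbabilityMeasure.continuous_map hf) continuous_id).isCompact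

variable {f : X → X}

/-- An upper semicontinuous entropy map which is finite has a real upper bound. -/
theorem exists_entropy_le (hf : Continuous f) (htop : Dynamics.coverEntropy f Set.univ < ⊤)
    (husc : UpperSemicontinuousOn
      (fun μ : ProbabilityMeasure X => entropy f (μ : Measure X)) (invariantMeasures f)) :
    ∃ C : ℝ, ∀ μ ∈ invariantMeasures f, entropy f (μ : Measure X) ≤ C := by
  rcases (invariantMeasures f).eq_empty_or_nonempty with h | h
  · exact ⟨0, by simp [h]⟩
  obtain ⟨μ, hμ, hmax⟩ := husc.exists_isMaxOn h (isCompact_invariantMeasures hf)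
  obtain ⟨C, hC, -⟩ := EReal.lt_iff_exists_real_btwn.1 (entropy_lt_top hf htop hμ)
  exact ⟨C, fun ν hν => (hmax hν).trans hC.le⟩

theorem equilibriumStates_nonempty (hf : Continuous f)
    (husc : UpperSemicontinuousOn
      (fun μ : ProbabilityMeasure X => entropy f (μ : Measure X)) (invariantMeasures f))
    (hne : (invariantMeasures f).Nonempty) {φ : X → ℝ} (hφ : Continuous φ) :
    (equilibriumStates f φ).Nonempty := by
  have hint : Continuous fun μ : ProbabilityMeasure X =>
      ((∫ x, φ x ∂(μ : Measure X) : ℝ) : EReal) :=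
    continuous_coe_real_ereal.comp (continuous_integral hφ)
  have h : UpperSemicontinuousOn (freeEnergy f φ) (invariantMeasures f) :=
    husc.add' (hint.upperSemicontinuous.upperSemicontinuousOn _) fun μ _ =>
      EReal.continuousAt_add (Or.inr (EReal.coe_ne_bot _)) (Or.inr (EReal.coe_ne_top _))
  obtain ⟨μ, hμ, hmax⟩ := h.exists_isMaxOn hne (isCompact_invariantMeasures hf)
  exact ⟨μ, hμ, le_antisymm (le_iSup₂ (f := fun ν _ => freeEnergy f φ ν) μ hμ)
    (iSup₂_le fun ν hν => hmax hν)⟩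

/-- Comparison of an equilibrium state of `t φ` with another invariant measure, with all
entropies read as real numbers. -/
theorem toReal_entropy_add_le_of_mem_equilibriumStates (hf : Continuous f)
    (htop : Dynamics.coverEntropy f Set.univ < ⊤) {φ : X → ℝ} {t : ℝ} {μ ν : ProbabilityMeasure X}
    (hμ : μ ∈ equilibriumStates f (fun x => t * φ x)) (hν : ν ∈ invariantMeasures f) :
    (entropy f (ν : Measure X)).toReal + t * ∫ x, φ x ∂(ν : Measure X) ≤
      (entropy f (μ : Measure X)).toReal + t * ∫ x, φ x ∂(μ : Measure X) := by
  have hfin : ∀ ρ ∈ invariantMeasures f,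
      (((entropy f (ρ : Measure X)).toReal : ℝ) : EReal) = entropy f (ρ : Measure X) := fun ρ hρ =>
    EReal.coe_toReal (entropy_lt_top hf htop hρ).ne
      (EReal.bot_lt_zero.trans_le (entropy_nonneg f (ρ : Measure X))).ne'
  have h : freeEnergy f (fun x => t * φ x) ν ≤ freeEnergy f (fun x => t * φ x) μ := by
    rw [hμ.2]
    exact le_iSup₂ (f := fun ν _ => freeEnergy f (fun x => t * φ x) ν) ν hν
  rw [freeEnergy, freeEnergy, ← hfin ν hν, ← hfin μ hμ.1, integral_const_mul,
    integral_const_mul] at h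
  exact_mod_cast h

/-- Ground states maximize the integral of the potential over the invariant measures, and maximize
the entropy among the measures maximizing the integral. -/
theorem integral_eq_and_entropy_le_of_mem_groundStates (hf : Continuous f)
    (htop : Dynamics.coverEntropy f Set.univ < ⊤)
    (husc : UpperSemicontinuousOn
      (fun μ : ProbabilityMeasure X => entropy f (μ : Measure X)) (invariantMeasures f))
    {φ : X → ℝ} (hφ : Continuous φ) {a : ℝ}
    (hle : ∀ ν ∈ invariantMeasures f, ∫ x, φ x ∂(ν : Measure X) ≤ a)
    (hex : ∃ ν ∈ invariantMeasures f, ∫ x, φ x ∂(ν : Measure X) = a)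
    {μ : ProbabilityMeasure X} (hμ : μ ∈ groundStates f φ) :
    ∫ x, φ x ∂(μ : Measure X) = a ∧ ∀ ν ∈ invariantMeasures f, ∫ x, φ x ∂(ν : Measure X) = a →
      entropy f (ν : Measure X) ≤ entropy f (μ : Measure X) := by
  obtain ⟨hμM, t, ρ, -, ht, hρ, hlim⟩ := hμ
  have hbot : ∀ ν : ProbabilityMeasure X, entropy f (ν : Measure X) ≠ ⊥ := fun ν =>
    (EReal.bot_lt_zero.trans_le (entropy_nonneg f (ν : Measure X))).ne'
  constructor
  · obtain ⟨ν, hν, hνa⟩ := hex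
    obtain ⟨C, hC⟩ := exists_entropy_le hf htop husc
    refine le_antisymm (hle μ hμM) ?_
    have h1 : Tendsto (fun n => ∫ x, φ x ∂(ρ n : Measure X)) atTop
        (𝓝 (∫ x, φ x ∂(μ : Measure X))) := ((continuous_integral hφ).tendsto μ).comp hlim
    -- Since h(ν) ≥ 0 and h(ρ n) ≤ C, the equilibrium inequality gives ∫φ dρ n ≥ a − C / t n.
    have h2 : Tendsto (fun n => a - C / t n) atTop (𝓝 a) := by
      simpa using tendsto_const_nhds.sub (ht.const_div_atTop C)
    refine le_of_tendsto_of_tendsto h2 h1 ?_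
    filter_upwards [ht.eventually_gt_atTop 0] with n hn
    have h3 := toReal_entropy_add_le_of_mem_equilibriumStates hf htop (hρ n) hν
    have h4 : 0 ≤ (entropy f (ν : Measure X)).toReal := EReal.toReal_nonneg (entropy_nonneg _ _)
    have h5 : (entropy f (ρ n : Measure X)).toReal ≤ C := by
      simpa using EReal.toReal_le_toReal (hC _ (hρ n).1) (hbot _) (EReal.coe_ne_top C)
    rw [hνa] at h3
    rw [sub_le_iff_le_add, ← sub_le_iff_le_add', le_div_iff₀ hn]
    nlinarith
  · intro ν hν hνa
    by_contra! hlt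
    -- By upper semicontinuity `ρ n` would eventually lose to `ν` in entropy, without gaining in the
    -- integral.
    have hev : ∀ᶠ n in atTop, entropy f (ρ n : Measure X) < entropy f (ν : Measure X) :=
      (tendsto_nhdsWithin_iff.2 ⟨hlim, Eventually.of_forall fun n => (hρ n).1⟩).eventually
        (husc μ hμM _ hlt)
    obtain ⟨n, hn, hn0⟩ := (hev.and (ht.eventually_gt_atTop 0)).exists
    have h3 := toReal_entropy_add_le_of_mem_equilibriumStates hf htop (hρ n) hν
    have h4 : (entropy f (ρ n : Measure X)).toReal < (entropy f (ν : Measure X)).toReal := by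
      rwa [← EReal.coe_lt_coe_iff, EReal.coe_toReal (entropy_lt_top hf htop (hρ n).1).ne (hbot _),
        EReal.coe_toReal (entropy_lt_top hf htop hν).ne (hbot _)]
    have h5 := mul_le_mul_of_nonneg_left (hle _ (hρ n).1) hn0.le
    rw [hνa] at h3
    linarith

/-- Equilibrium states at temperatures tending to zero accumulate at a ground state. -/
theorem exists_subseq_tendsto_groundState (hf : Continuous f) {φ : X → ℝ} {t : ℕ → ℝ}
    (ht : Tendsto t atTop atTop) {ν : ℕ → ProbabilityMeasure X}
    (hν : ∀ᶠ n in atTop, ν n ∈ equilibriumStates f (fun x => t n * φ x)) :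
    ∃ μ ∈ groundStates f φ, ∃ θ : ℕ → ℕ, Tendsto (ν ∘ θ) atTop (𝓝 μ) := by
  obtain ⟨N, hN⟩ := eventually_atTop.1 hν
  -- Ground states require strictly increasing parameters; these are arranged first, and the later
  -- compactness subsequence preserves this.
  obtain ⟨θ, hθ, hθt⟩ := strictMono_subseq_of_tendsto_atTop
    (ht.comp (tendsto_add_atTop_nat N))
  have hθ' : ∀ n, ν (θ n + N) ∈ equilibriumStates f (fun x => t (θ n + N) * φ x) := fun n =>
    hN _ (Nat.le_add_left _ _)
  obtain ⟨μ, hμ, χ, hχ, hlim⟩ := (isCompact_invariantMeasures hf).tendsto_subseq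
    (x := fun n => ν (θ n + N)) fun n => (hθ' n).1
  have hmono : StrictMono fun n => t (θ (χ n) + N) := hθt.comp hχ
  refine ⟨μ, ⟨hμ, fun n => t (θ (χ n) + N), fun n => ν (θ (χ n) + N), hmono, ?_,
    fun n => hθ' (χ n), hlim⟩, fun n => θ (χ n) + N, hlim⟩
  exact ht.comp ((tendsto_add_atTop_nat N).comp (hθ.comp hχ).tendsto_atTop)

/-! ### Rotation vectors and exposed points -/

theorem integral_dotPotential {m : ℕ} {Φ : X → EuclideanSpace ℝ (Fin m)} (hΦ : Continuous Φ)
    (α : EuclideanSpace ℝ (Fin m)) (μ : ProbabilityMeasure X) :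
    ∫ x, dotPotential α Φ x ∂(μ : Measure X) = inner ℝ α (rv Φ μ) := by
  simp only [dotPotential, rv, PiLp.inner_apply]
  rw [integral_finsetSum]
  · refine Finset.sum_congr rfl fun i _ => ?_
    simp [integral_mul_const]
  · exact fun i _ => integrable_of_continuous (by fun_prop) _

/-- If `F_α(Φ) = {w}`, then every ground state in direction `α` is a localized measure of maximal
entropy at `w`. -/
theorem groundStates_dotPotential_subset (hf : Continuous f)
    (htop : Dynamics.coverEntropy f Set.univ < ⊤)
    (husc : UpperSemicontinuousOn
      (fun μ : ProbabilityMeasure X => entropy f (μ : Measure X)) (invariantMeasures f))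
    {m : ℕ} {Φ : X → EuclideanSpace ℝ (Fin m)} (hΦ : Continuous Φ)
    {w α : EuclideanSpace ℝ (Fin m)} (hw : w ∈ Rot f Φ) (hα : α ∈ directionVectors f Φ w)
    (hface : face f Φ α = {w}) :
    groundStates f (dotPotential α Φ) ⊆ localizedMaxEntropyMeasures f Φ w := by
  intro μ hμ
  obtain ⟨-, a, hsupp, hle, hwa⟩ := hα
  change inner ℝ α w = a at hwa
  obtain ⟨ν₀, hν₀, hν₀w⟩ := hw
  obtain ⟨hμa, hmax⟩ := integral_eq_and_entropy_le_of_mem_groundStates hf htop husc (φ := dotPotential α Φ)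
    (continuous_const.inner hΦ)
    (a := a) (fun ν hν => by
      rw [integral_dotPotential hΦ]
      exact not_lt.1 (hle _ ⟨ν, hν, rfl⟩))
    ⟨ν₀, hν₀, by rw [integral_dotPotential hΦ, hν₀w, hwa]⟩ hμ
  rw [integral_dotPotential hΦ] at hμa
  have hμw : rv Φ μ = w := by
    have : rv Φ μ ∈ face f Φ α := ⟨⟨μ, hμ.1, rfl⟩, a, hsupp, hle, hμa⟩
    rwa [hface] at this
  refine ⟨⟨hμ.1, hμw⟩, le_antisymm (le_iSup₂ (f := fun ν : ProbabilityMeasure X =>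
    fun _ : ν ∈ rotationClass f Φ w => entropy f (ν : Measure X)) μ ⟨hμ.1, hμw⟩) ?_⟩
  refine iSup₂_le fun ν hν => hmax ν hν.1 ?_
  rw [integral_dotPotential hΦ, hν.2, hwa]

end

end RotEntropy

theorem corollary4 {X : Type*} [MetricSpace X] [CompactSpace X] [MeasurableSpace X] [BorelSpace X]
    (f : X → X) (hf : Continuous f)
    (htop : Dynamics.coverEntropy f Set.univ < ⊤)
    (husc : UpperSemicontinuousOn
      (fun μ : ProbabilityMeasure X => RotEntropy.entropy f (μ : Measure X))
      (RotEntropy.invariantMeasures f))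
    (m : ℕ) (Φ : X → EuclideanSpace ℝ (Fin m)) (hΦ : Continuous Φ)
    (w : EuclideanSpace ℝ (Fin m)) (hw : w ∈ frontier (RotEntropy.Rot f Φ))
    (hexp : RotEntropy.IsExposedPoint (RotEntropy.Rot f Φ) w) :
    (∀ α ∈ RotEntropy.directionVectors f Φ w, RotEntropy.face f Φ α = {w} →
      ∀ μ ∈ RotEntropy.groundStates f (RotEntropy.dotPotential α Φ),
        RotEntropy.rv Φ μ = w ∧
          RotEntropy.entropy f (μ : Measure X) =
            ⨆ ν ∈ RotEntropy.rotationClass f Φ w, RotEntropy.entropy f (ν : Measure X)) ∧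
    (∀ μ : ProbabilityMeasure X, RotEntropy.localizedMaxEntropyMeasures f Φ w = {μ} →
      ∀ α ∈ RotEntropy.directionVectors f Φ w, RotEntropy.face f Φ α = {w} →
        RotEntropy.groundStates f (RotEntropy.dotPotential α Φ) = {μ} ∧
        ((∃ t₀ : ℝ, ∀ t, t₀ ≤ t → ∃ ν : ProbabilityMeasure X,
            RotEntropy.equilibriumStates f
              (fun x => t * RotEntropy.dotPotential α Φ x) = {ν}) →
          RotEntropy.IsZeroTemperatureMeasure f (RotEntropy.dotPotential α Φ) μ)) := by
  have hground : ∀ α ∈ RotEntropy.directionVectors f Φ w, RotEntropy.face f Φ α = {w} →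
      RotEntropy.groundStates f (RotEntropy.dotPotential α Φ) ⊆
        RotEntropy.localizedMaxEntropyMeasures f Φ w := fun α hα hface =>
    RotEntropy.groundStates_dotPotential_subset hf htop husc hΦ hexp.1 hα hface
  refine ⟨fun α hα hface μ hμ =>
    ⟨(hground α hα hface hμ).1.2, (hground α hα hface hμ).2⟩, fun μ hμ α hα hface => ?_⟩
  have hcont : Continuous (RotEntropy.dotPotential α Φ) := continuous_const.inner hΦ
  have hsub : ∀ ρ ∈ RotEntropy.groundStates f (RotEntropy.dotPotential α Φ), ρ = μ := fun ρ hρ => by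
    have h := hground α hα hface hρ
    rwa [hμ] at h
  have hμmem : μ ∈ RotEntropy.localizedMaxEntropyMeasures f Φ w := hμ ▸ Set.mem_singleton μ
  have hμM : μ ∈ RotEntropy.invariantMeasures f := hμmem.1.1
  constructor
  · refine Set.eq_singleton_iff_unique_mem.2 ⟨?_, hsub⟩
    choose ν hν using fun n : ℕ => RotEntropy.equilibriumStates_nonempty hf husc ⟨μ, hμM⟩
      (hcont.const_mul (n : ℝ))
    obtain ⟨ρ, hρ, -⟩ := RotEntropy.exists_subseq_tendsto_groundState hf tendsto_natCast_atTop_atTop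
      (Eventually.of_forall hν)
    exact hsub ρ hρ ▸ hρ
  · rintro ⟨t₀, ht₀⟩
    -- Below `t₀` the value is irrelevant; `μ` serves as a default.
    have hex : ∀ t, ∃ ν, t₀ ≤ t →
        RotEntropy.equilibriumStates f (fun x => t * RotEntropy.dotPotential α Φ x) = {ν} := fun t => by
      by_cases h : t₀ ≤ t
      · exact (ht₀ t h).imp fun ν hν _ => hν
      · exact ⟨μ, fun h' => absurd h' h⟩
    choose ν hν using hex
    refine ⟨hμM, max t₀ 0, ν, le_max_right _ _, fun t ht => hν t (le_of_max_le_left ht), ?_⟩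
    -- Every sequence of parameters tending to infinity has a subsequence along which `ν` converges
    -- to a ground state, necessarily `μ`.
    refine tendsto_of_subseq_tendsto fun s hs => ?_
    obtain ⟨ρ, hρ, θ, hθ⟩ := RotEntropy.exists_subseq_tendsto_groundState hf hs (ν := ν ∘ s)
      (φ := RotEntropy.dotPotential α Φ) (by
        filter_upwards [hs.eventually_ge_atTop t₀] with n hn
        rw [hν _ hn]
        exact Set.mem_singleton _)
    exact ⟨θ, hsub ρ hρ ▸ hθ⟩
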